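/- Rings are associative and need not have a unit. Two idempotents $p,q$ of a ring $S$ are equivalent, $p\sim q$, if there are $x,y\in S$ with $xy=p$ and $yx=q$. An idempotent $e\in S$ is infinite if $e=f+g$ for idempotents $f,g\in S$ with $fg=gf=0$, $e\sim f$ and $g\neq 0$. A ring $R$ is purely infinite simple if it is simple and every nonzero right ideal of $R$ contains an infinite idempotent. For such $R$, the multiplier ring $\mathcal M(R)$ consists of the pairs $m=(f,g)$ of a right $R$-module morphism $f:R\to R$ and a left $R$-module morphism $g:R\to R$ with $g(x)y=xf(y)$ for all $x,y\in R$, with componentwise addition and product $(f_1,g_1)(f_2,g_2)=(f_1f_2,\,g_2g_1)$; its unit is $1=(\mathrm{id},\mathrm{id})$. For $a\in R$ put $ma=f(a)$ and $am=g(a)$, and identify $a$ with the multiplier $(x\mapsto ax,\ x\mapsto xa)$. A net $(x_\lambda)$ in $\mathcal M(R)$ converges to $m\in\mathcal M(R)$ in the strict topology if for every $a\in R$ there is $\lambda_0$ such that $(x_\lambda-m)a=a(x_\lambda-m)=0$ for all $\lambda\ge\lambda_0$. The ring $R$ is $\sigma$-unital if some sequence in $R$ converges to $1$ in the strict topology.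 **Lemma.** Let $R$ be a $\sigma$-unital purely infinite simple ring without unit element, let $(p_n)_{n\ge1}$ be a sequence of nonzero pairwise orthogonal idempotents of $R$ (so $p_ip_j=0$ for $i\ne j$), and let $P\in\mathcal M(R)$ be such that $\sum_{i=1}^n p_i\to P$ in the strict topology. Then $P$ is an idempotent and $P\sim 1$ in $\mathcal M(R)$, that is, there are $x,y\in\mathcal M(R)$ with $xy=P$ and $yx=1$. -/

import Mathlib

/-!
Rings are associative and need not have a unit (`NonUnitalRing`).
-/

namespace PurelyInfinite

universe u v

section Idempotents

variable {R : Type u}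

/-- Equivalence `p ∼ q` of two idempotents: `x * y = p` and `y * x = q` for some `x`, `y` in the
ring. (For idempotents `p`, `q` of `R`, allowing `x`, `y` to be matrices over `R` gives the same
relation: replace `x` by `p * x * q` and `y` by `q * y * p`, which lie in the corner `R`.) -/
def IdemEquiv [Mul R] (p q : R) : Prop :=
  IsIdempotentElem p ∧ IsIdempotentElem q ∧ ∃ x y : R, x * y = p ∧ y * x = q

/-- `e` is an infinite idempotent: `e = f + g` with `f`, `g` orthogonal idempotents, `e ∼ f` and
`g ≠ 0`. -/
def IsInfiniteIdempotent [NonUnitalRing R] (e : R) : Prop :=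
  IsIdempotentElem e ∧ ∃ f g : R, IsIdempotentElem f ∧ IsIdempotentElem g ∧
    f * g = 0 ∧ g * f = 0 ∧ e = f + g ∧ IdemEquiv e f ∧ g ≠ 0

end Idempotents

section Rings

variable (R : Type u) [NonUnitalRing R]

/-- `R` has a two-sided unit element. -/
def IsUnital : Prop := ∃ e : R, ∀ a : R, e * a = a ∧ a * e = a

/-- `R` is purely infinite simple: it is simple, and every nonzero right ideal contains an
infinite idempotent. -/
def IsPurelyInfiniteSimple : Prop :=
  IsSimpleRing R ∧
    ∀ I : AddSubgroup R, (∀ a ∈ I, ∀ r : R, a * r ∈ I) → I ≠ ⊥ →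
      ∃ e ∈ I, IsInfiniteIdempotent e

/-- The ring of multipliers of `R`: the pairs `(f, g)` of a right module morphism `f : R → R` and
a left module morphism `g : R → R` with `g x * y = x * f y`, with componentwise addition and
product `(f₁, g₁) * (f₂, g₂) = (f₁ ∘ f₂, g₂ ∘ g₁)` (whence the opposite ring in the second
component). -/
def multiplierRing : Subring (AddMonoid.End R × (AddMonoid.End R)ᵐᵒᵖ) where
  carrier := {m | (∀ x y : R, m.1 (x * y) = m.1 x * y) ∧
    (∀ x y : R, m.2.unop (x * y) = x * m.2.unop y) ∧
    (∀ x y : R, m.2.unop x * y = x * m.1 y)}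
  mul_mem' := by
    rintro a b ⟨ha1, ha2, ha3⟩ ⟨hb1, hb2, hb3⟩
    refine ⟨fun x y => ?_, fun x y => ?_, fun x y => ?_⟩
    · simp [hb1, ha1]
    · simp [hb2, ha2]
    · simp [ha3, hb3]
  one_mem' := ⟨fun _ _ => rfl, fun _ _ => rfl, fun _ _ => rfl⟩
  add_mem' := by
    rintro a b ⟨ha1, ha2, ha3⟩ ⟨hb1, hb2, hb3⟩
    refine ⟨fun x y => ?_, fun x y => ?_, fun x y => ?_⟩
    · change a.1 (x * y) + b.1 (x * y) = (a.1 x + b.1 x) * y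
      rw [ha1, hb1, add_mul]
    · change a.2.unop (x * y) + b.2.unop (x * y) = x * (a.2.unop y + b.2.unop y)
      rw [ha2, hb2, mul_add]
    · change (a.2.unop x + b.2.unop x) * y = x * (a.1 y + b.1 y)
      rw [add_mul, mul_add, ha3, hb3]
  zero_mem' :=
    ⟨fun _ y => (zero_mul y).symm, fun x _ => (mul_zero x).symm,
      fun x y => (zero_mul y).trans (mul_zero x).symm⟩
  neg_mem' := by
    rintro a ⟨ha1, ha2, ha3⟩
    refine ⟨fun x y => ?_, fun x y => ?_, fun x y => ?_⟩
    · change -a.1 (x * y) = -a.1 x * y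
      rw [ha1, neg_mul]
    · change -a.2.unop (x * y) = x * -a.2.unop y
      rw [ha2, mul_neg]
    · change -a.2.unop x * y = x * -a.1 y
      rw [neg_mul, mul_neg, ha3]

end Rings

section Strict

variable {R : Type u} [NonUnitalRing R]

/-- The action `m a = f a` of a multiplier `m = (f, g)` from the left on an element of `R`. -/
def leftAct (m : multiplierRing R) (a : R) : R := m.1.1 a

/-- The action `a m = g a` of a multiplier `m = (f, g)` from the right on an element of `R`. -/
def rightAct (m : multiplierRing R) (a : R) : R := m.1.2.unop a

/-- The multiplier given by left and right multiplication by `a`. -/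
def toMultiplier (a : R) : multiplierRing R :=
  ⟨(AddMonoid.End.mulLeft a, MulOpposite.op (AddMonoid.End.mulRight a)),
    fun x y => (mul_assoc a x y).symm, fun x y => mul_assoc x y a,
    fun x y => mul_assoc x a y⟩

/-- The net `x` converges to `m` in the strict topology: for every `a` in `R`, eventually
`(x l - m) a = 0` and `a (x l - m) = 0`. -/
def StrictTendsto {Λ : Type v} [Preorder Λ] (x : Λ → multiplierRing R) (m : multiplierRing R) :
    Prop :=
  ∀ a : R, ∃ l₀ : Λ, ∀ l ≥ l₀,
    leftAct (x l - m) a = 0 ∧ rightAct (x l - m) a = 0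

variable (R) in
/-- `R` is σ-unital: some sequence in `R` converges strictly to `1`. -/
def IsSigmaUnital : Prop :=
  ∃ w : ℕ → R, StrictTendsto (fun n => toMultiplier (w n)) 1

end Strict

end PurelyInfinite

namespace PurelyInfinite

universe u

/-! ### Strict limits of multipliers and sums of series -/

section StrictLimits

variable {R : Type u} [NonUnitalRing R]

/-! The unit is itself a strict sum of nonzero orthogonal idempotents `e n`
(`exists_idempotent_series`), so two such series must be compared. The `p n` and `e n` need not be
equivalent term by term, so the `e n` are cut and regrouped.

Start with `r 0 = e 0`. Pure infiniteness embeds `r n` in `p n`, and what remains of `p n` in `e (n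
+ 1)`; let `r (n + 1)` be the unused part of `e (n + 1)`. Then `p n` is equivalent to `r n + e (n +
1) - r (n + 1)` (`exchange_step`, `exists_matching`). The new series telescopes, and its sum is
still `1` because `r n`, lying under `e n`, tends strictly to zero (`shifted_tendsto`). The termwise
equivalences then add up to one between `P` and `1` (`exists_mul_eq_of_series`). -/

theorem multiplier_ext {m m' : multiplierRing R} (hl : ∀ a, leftAct m a = leftAct m' a)
    (hr : ∀ a, rightAct m a = rightAct m' a) : m = m' := by
  apply Subtype.ext
  apply Prod.ext
  · exact AddMonoidHom.ext hl
  · exact MulOpposite.unop_injective (AddMonoidHom.ext hr)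

theorem leftAct_sub (m m' : multiplierRing R) (a : R) :
    leftAct (m - m') a = leftAct m a - leftAct m' a := rfl

theorem rightAct_sub (m m' : multiplierRing R) (a : R) :
    rightAct (m - m') a = rightAct m a - rightAct m' a := rfl

theorem leftAct_mul (m m' : multiplierRing R) (a : R) :
    leftAct (m * m') a = leftAct m (leftAct m' a) := rfl

theorem rightAct_mul (m m' : multiplierRing R) (a : R) :
    rightAct (m * m') a = rightAct m' (rightAct m a) := rfl

theorem leftAct_toMultiplier (a b : R) : leftAct (toMultiplier a) b = a * b := rfl

theorem rightAct_toMultiplier (a b : R) : rightAct (toMultiplier a) b = b * a := rfl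

theorem leftAct_one (a : R) : leftAct (1 : multiplierRing R) a = a := rfl

theorem rightAct_one (a : R) : rightAct (1 : multiplierRing R) a = a := rfl

theorem toMultiplier_mul (a b : R) :
    toMultiplier (a * b) = toMultiplier a * toMultiplier b :=
  multiplier_ext (fun c => mul_assoc a b c) (fun c => (mul_assoc c a b).symm)

theorem strictTendsto_iff {x : ℕ → multiplierRing R} {m : multiplierRing R} :
    StrictTendsto x m ↔ ∀ a : R, ∃ N : ℕ, ∀ n ≥ N,
      leftAct (x n) a = leftAct m a ∧ rightAct (x n) a = rightAct m a := by
  simp only [StrictTendsto, leftAct_sub, rightAct_sub, sub_eq_zero]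

theorem StrictTendsto.unique {x : ℕ → multiplierRing R} {m m' : multiplierRing R}
    (h : StrictTendsto x m) (h' : StrictTendsto x m') : m = m' := by
  rw [strictTendsto_iff] at h h'
  have key : ∀ a, leftAct m a = leftAct m' a ∧ rightAct m a = rightAct m' a := by
    intro a
    obtain ⟨N, hN⟩ := h a
    obtain ⟨N', hN'⟩ := h' a
    have h1 := hN (max N N') (le_max_left _ _)
    have h2 := hN' (max N N') (le_max_right _ _)
    exact ⟨h1.1.symm.trans h2.1, h1.2.symm.trans h2.2⟩
  exact multiplier_ext (fun a => (key a).1) (fun a => (key a).2)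

theorem StrictTendsto.mul {x y : ℕ → multiplierRing R} {m m' : multiplierRing R}
    (h : StrictTendsto x m) (h' : StrictTendsto y m') :
    StrictTendsto (fun n => x n * y n) (m * m') := by
  rw [strictTendsto_iff] at h h' ⊢
  intro a
  obtain ⟨N₁, h₁⟩ := h' a
  obtain ⟨N₂, h₂⟩ := h (leftAct m' a)
  obtain ⟨N₃, h₃⟩ := h a
  obtain ⟨N₄, h₄⟩ := h' (rightAct m a)
  refine ⟨max (max N₁ N₂) (max N₃ N₄), fun n hn => ?_⟩
  simp only [ge_iff_le, max_le_iff] at hn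
  simp only [leftAct_mul, rightAct_mul]
  rw [(h₁ n hn.1.1).1, (h₂ n hn.1.2).1, (h₃ n hn.2.1).2, (h₄ n hn.2.2).2]
  exact ⟨rfl, rfl⟩

/-- A strict Cauchy sequence of elements of `R` converges to a multiplier. -/
theorem exists_strictTendsto {u : ℕ → R}
    (hu : ∀ a, ∃ N, ∀ n ≥ N, u n * a = u N * a ∧ a * u n = a * u N) :
    ∃ m : multiplierRing R, StrictTendsto (fun n => toMultiplier (u n)) m := by
  choose N hN using hu
  let f : R → R := fun a => u (N a) * a
  let g : R → R := fun a => a * u (N a)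
  have hf : ∀ a, ∀ n ≥ N a, u n * a = f a := fun a n hn => (hN a n hn).1
  have hg : ∀ a, ∀ n ≥ N a, a * u n = g a := fun a n hn => (hN a n hn).2
  have eq3 : ∀ a b c : R, ∃ n, n ≥ N a ∧ n ≥ N b ∧ n ≥ N c := fun a b c =>
    ⟨max (N a) (max (N b) (N c)), le_max_left _ _,
      (le_max_left _ _).trans (le_max_right _ _), (le_max_right _ _).trans (le_max_right _ _)⟩
  let F : AddMonoid.End R := AddMonoidHom.mk' f (by
    intro a b
    obtain ⟨n, h1, h2, h3⟩ := eq3 a b (a + b)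
    rw [← hf a n h1, ← hf b n h2, ← hf _ n h3, mul_add])
  let G : AddMonoid.End R := AddMonoidHom.mk' g (by
    intro a b
    obtain ⟨n, h1, h2, h3⟩ := eq3 a b (a + b)
    rw [← hg a n h1, ← hg b n h2, ← hg _ n h3, add_mul])
  refine ⟨⟨(F, MulOpposite.op G), ?_, ?_, ?_⟩, ?_⟩
  · intro x y
    change f (x * y) = f x * y
    obtain ⟨n, h1, h2, -⟩ := eq3 x (x * y) x
    rw [← hf _ n h1, ← hf _ n h2, mul_assoc]
  · intro x y
    change g (x * y) = x * g y
    obtain ⟨n, h1, h2, -⟩ := eq3 y (x * y) x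
    rw [← hg _ n h1, ← hg _ n h2, mul_assoc]
  · intro x y
    change g x * y = x * f y
    obtain ⟨n, h1, h2, -⟩ := eq3 x y x
    rw [← hg _ n h1, ← hf _ n h2, mul_assoc]
  · rw [strictTendsto_iff]
    exact fun a => ⟨N a, fun n hn => ⟨hf a n hn, hg a n hn⟩⟩

theorem exists_strictTendsto_sum {x : ℕ → R}
    (hx : ∀ a, ∃ N, ∀ n ≥ N, x n * a = 0 ∧ a * x n = 0) :
    ∃ m : multiplierRing R,
      StrictTendsto (fun n => toMultiplier (∑ i ∈ Finset.range n, x i)) m := by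
  apply exists_strictTendsto
  intro a
  obtain ⟨N, hN⟩ := hx a
  refine ⟨N, fun n hn => ?_⟩
  induction n, hn using Nat.le_induction with
  | base => exact ⟨rfl, rfl⟩
  | succ n hn ih =>
    rw [Finset.sum_range_succ, add_mul, mul_add, (hN n hn).1, (hN n hn).2, add_zero, add_zero]
    exact ih

/-- The terms of a strictly convergent series tend strictly to zero. -/
theorem StrictTendsto.terms {x : ℕ → R} {m : multiplierRing R}
    (h : StrictTendsto (fun n => toMultiplier (∑ i ∈ Finset.range n, x i)) m) (a : R) :
    ∃ N, ∀ n ≥ N, x n * a = 0 ∧ a * x n = 0 := by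
  rw [strictTendsto_iff] at h
  obtain ⟨N, hN⟩ := h a
  refine ⟨N, fun n hn => ?_⟩
  have h1 := hN n hn
  have h2 := hN (n + 1) (by omega)
  simp only [leftAct_toMultiplier, rightAct_toMultiplier, Finset.sum_range_succ, add_mul,
    mul_add] at h1 h2
  rw [h1.1, h1.2] at h2
  simpa using h2

/-- Termwise equivalent strictly convergent series have equivalent sums. -/
theorem exists_mul_eq_of_series {p q x y : ℕ → R} {P Q : multiplierRing R}
    (hP : StrictTendsto (fun n => toMultiplier (∑ i ∈ Finset.range n, p i)) P)
    (hQ : StrictTendsto (fun n => toMultiplier (∑ i ∈ Finset.range n, q i)) Q)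
    (hpo : ∀ i j, i ≠ j → p i * p j = 0) (hqo : ∀ i j, i ≠ j → q i * q j = 0)
    (hxy : ∀ n, x n * y n = p n) (hyx : ∀ n, y n * x n = q n)
    (hpx : ∀ n, p n * x n = x n) (hyp : ∀ n, y n * p n = y n) :
    ∃ X Y : multiplierRing R, X * Y = P ∧ Y * X = Q := by
  have hxq : ∀ n, x n * q n = x n := fun n => by rw [← hyx, ← mul_assoc, hxy, hpx]
  have hqy : ∀ n, q n * y n = y n := fun n => by rw [← hyx, mul_assoc, hxy, hyp]
  -- Since `x n = p n * x n * q n`, smallness on the left comes from `p` and on the right from `q`.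
  obtain ⟨X, hX⟩ := exists_strictTendsto_sum (x := x) (by
    intro a
    obtain ⟨N, hN⟩ := hP.terms a
    obtain ⟨M, hM⟩ := hQ.terms a
    refine ⟨max N M, fun n hn => ⟨?_, ?_⟩⟩
    · rw [← hxq, mul_assoc, (hM n (le_of_max_le_right hn)).1, mul_zero]
    · rw [← hpx, ← mul_assoc, (hN n (le_of_max_le_left hn)).2, zero_mul])
  obtain ⟨Y, hY⟩ := exists_strictTendsto_sum (x := y) (by
    intro a
    obtain ⟨N, hN⟩ := hP.terms a
    obtain ⟨M, hM⟩ := hQ.terms a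
    refine ⟨max N M, fun n hn => ⟨?_, ?_⟩⟩
    · rw [← hyp, mul_assoc, (hN n (le_of_max_le_left hn)).1, mul_zero]
    · rw [← hqy, ← mul_assoc, (hM n (le_of_max_le_right hn)).2, zero_mul])
  refine ⟨X, Y, (hX.mul hY).unique ?_, (hY.mul hX).unique ?_⟩
  · convert hP using 2 with n
    rw [← toMultiplier_mul, Finset.sum_mul_sum]
    congr 1
    refine Finset.sum_congr rfl fun i hi => ?_
    rw [Finset.sum_eq_single_of_mem i hi, hxy]
    intro j _ hji
    rw [← hxq, ← hqy j, mul_assoc, ← mul_assoc (q i), hqo i j hji.symm, zero_mul, mul_zero]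
  · convert hQ using 2 with n
    rw [← toMultiplier_mul, Finset.sum_mul_sum]
    congr 1
    refine Finset.sum_congr rfl fun i hi => ?_
    rw [Finset.sum_eq_single_of_mem i hi, hyx]
    intro j _ hji
    rw [← hyp, ← hpx j, mul_assoc, ← mul_assoc (p i), hpo i j hji.symm, zero_mul, mul_zero]

end StrictLimits

/-! ### Comparison of idempotents in a purely infinite simple ring -/

section Comparison

variable {R : Type u} [NonUnitalRing R]

/-- The span of `R g R` is a two-sided ideal, and it contains `g = g * g * g`, so simplicity leaves
no choice. Without a unit, idempotency is what puts `g` in it. -/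
theorem closure_mul_mul_eq_top [IsSimpleRing R] {g : R} (hg : IsIdempotentElem g) (hg0 : g ≠ 0)
    (b : R) : b ∈ AddSubgroup.closure {c : R | ∃ r s, c = r * g * s} := by
  set S := {c : R | ∃ r s, c = r * g * s} with hS
  let J : TwoSidedIdeal R := TwoSidedIdeal.mk' (AddSubgroup.closure S : Set R)
    (AddSubgroup.zero_mem _) (fun hx hy => AddSubgroup.add_mem _ hx hy)
    (fun hx => AddSubgroup.neg_mem _ hx)
    (by
      intro x y hy
      refine AddSubgroup.closure_induction (p := fun y _ => x * y ∈ AddSubgroup.closure S)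
        ?_ ?_ ?_ ?_ hy
      · rintro _ ⟨r, s, rfl⟩
        exact AddSubgroup.subset_closure ⟨x * r, s, by simp only [mul_assoc]⟩
      · simp
      · intro a b _ _ ha hb
        rw [mul_add]; exact AddSubgroup.add_mem _ ha hb
      · intro a _ ha
        rw [mul_neg]; exact AddSubgroup.neg_mem _ ha)
    (by
      intro y x hy
      refine AddSubgroup.closure_induction (p := fun y _ => y * x ∈ AddSubgroup.closure S)
        ?_ ?_ ?_ ?_ hy
      · rintro _ ⟨r, s, rfl⟩
        exact AddSubgroup.subset_closure ⟨r, s * x, by simp only [mul_assoc]⟩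
      · simp
      · intro a b _ _ ha hb
        rw [add_mul]; exact AddSubgroup.add_mem _ ha hb
      · intro a _ ha
        rw [neg_mul]; exact AddSubgroup.neg_mem _ ha)
  have hJ : ∀ c, c ∈ J ↔ c ∈ AddSubgroup.closure S := fun c => TwoSidedIdeal.mem_mk' ..
  rcases eq_bot_or_eq_top J with h | h
  · exfalso
    apply hg0
    have : g ∈ J := (hJ g).2 (AddSubgroup.subset_closure ⟨g, g, by rw [hg.eq, hg.eq]⟩)
    rw [h] at this
    exact (TwoSidedIdeal.mem_bot R).1 this
  · rw [← hJ, h]; trivial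

theorem IsInfiniteIdempotent.ne_zero {e : R} (he : IsInfiniteIdempotent e) : e ≠ 0 := by
  obtain ⟨-, f, g, -, hg, hfg, -, hefg, -, hg0⟩ := he
  intro h
  apply hg0
  calc g = f * g + g * g := by rw [hfg, hg.eq, zero_add]
    _ = 0 := by rw [← add_mul, ← hefg, h, zero_mul]

/-- In a simple ring every element factors through a given infinite idempotent. -/
theorem IsInfiniteIdempotent.factor [IsSimpleRing R] {e : R} (he : IsInfiniteIdempotent e)
    (b : R) : ∃ y x : R, y * e = y ∧ e * x = x ∧ y * x = b := by
  obtain ⟨hee, f, g, hf, hg, hfg, hgf, hefg, ⟨-, -, s₀, t₀, hst₀, hts₀⟩, hg0⟩ := he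
  have hfe : f * e = f := by rw [hefg, mul_add, hf.eq, hfg, add_zero]
  have hef : e * f = f := by rw [hefg, add_mul, hf.eq, hgf, add_zero]
  have hge : g * e = g := by rw [hefg, mul_add, hg.eq, hgf, zero_add]
  have heg : e * g = g := by rw [hefg, add_mul, hg.eq, hfg, zero_add]
  obtain ⟨s, t, hs, ht, hst⟩ : ∃ s t, s * f = s ∧ f * t = t ∧ s * t = e := by
    refine ⟨s₀ * f, f * t₀, by rw [mul_assoc, hf.eq], by rw [← mul_assoc, hf.eq], ?_⟩
    calc s₀ * f * (f * t₀) = s₀ * (f * f) * t₀ := by simp only [mul_assoc]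
      _ = (s₀ * t₀) * (s₀ * t₀) := by rw [hf.eq, ← hts₀]; simp only [mul_assoc]
      _ = e := by rw [hst₀, hee.eq]
  have step : ∀ b r r' : R, (∃ y x : R, y * e = y ∧ e * x = x ∧ y * x = b) →
      ∃ y x : R, y * e = y ∧ e * x = x ∧ y * x = b + r * g * r' := by
    rintro b r r' ⟨y, x, hy, hx, rfl⟩
    -- Since `e ∼ f`, the old factorization is rerouted through `f`; this frees the orthogonal `g`
    -- to carry the new term.
    refine ⟨y * s + r * g, t * x + g * r', ?_, ?_, ?_⟩
    · rw [add_mul, mul_assoc, mul_assoc, hge, ← hs, mul_assoc s, hfe]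
    · rw [mul_add, ← mul_assoc, ← mul_assoc, heg, ← ht, ← mul_assoc e, hef]
    · have h1 : s * g = 0 := by rw [← hs, mul_assoc, hfg, mul_zero]
      have h2 : g * t = 0 := by rw [← ht, ← mul_assoc, hgf, zero_mul]
      calc (y * s + r * g) * (t * x + g * r')
          = y * (s * t) * x + y * (s * g) * r' + r * (g * t) * x + r * (g * g) * r' := by
            noncomm_ring
        _ = y * x + r * g * r' := by rw [hst, h1, h2, hg.eq, hy]; simp
  have hb := closure_mul_mul_eq_top hg hg0 b
  -- Adding `b` to an arbitrary factorable `c` makes the statement inductive: two elements that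
  -- factor through `e` cannot be added directly.
  have key : ∀ c : R, (∃ y x : R, y * e = y ∧ e * x = x ∧ y * x = c) →
      ∃ y x : R, y * e = y ∧ e * x = x ∧ y * x = c + b := by
    refine AddSubgroup.closure_induction (p := fun b _ => ∀ c : R,
      (∃ y x : R, y * e = y ∧ e * x = x ∧ y * x = c) →
      ∃ y x : R, y * e = y ∧ e * x = x ∧ y * x = c + b) ?_ ?_ ?_ ?_ hb
    · rintro _ ⟨r, r', rfl⟩ c hc
      exact step c r r' hc
    · intro c hc
      rwa [add_zero]
    · intro b b' _ _ h h' c hc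
      rw [← add_assoc]
      exact h' _ (h _ hc)
    · rintro b _ h c ⟨y, x, hy, hx, rfl⟩
      obtain ⟨y', x', hy', hx', h'⟩ := h (-(y * x)) ⟨-y, x, by rw [neg_mul, hy], hx, neg_mul _ _⟩
      exact ⟨-y', x', by rw [neg_mul, hy'], hx', by rw [neg_mul, h']; abel⟩
  simpa using key 0 ⟨0, 0, by simp, by simp, by simp⟩

theorem IsPurelyInfiniteSimple.exists_infinite (hR : IsPurelyInfiniteSimple R) {k : R}
    (hk : IsIdempotentElem k) (hk0 : k ≠ 0) : ∃ e, IsInfiniteIdempotent e ∧ k * e = e := by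
  obtain ⟨e, he, hinf⟩ := hR.2 (AddMonoidHom.mulLeft k).range
    (by
      rintro _ ⟨x, rfl⟩ r
      exact ⟨x * r, (mul_assoc _ _ _).symm⟩)
    (by
      intro h
      have : k ∈ (AddMonoidHom.mulLeft k).range := ⟨k, hk⟩
      rw [h] at this
      exact hk0 this)
  refine ⟨e, hinf, ?_⟩
  obtain ⟨x, rfl⟩ := he
  change k * (k * x) = k * x
  rw [← mul_assoc, hk.eq]

/-- Every element factors through every nonzero idempotent. -/
theorem IsPurelyInfiniteSimple.factor (hR : IsPurelyInfiniteSimple R) {k : R}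
    (hk : IsIdempotentElem k) (hk0 : k ≠ 0) (b : R) :
    ∃ y x : R, y * k = y ∧ k * x = x ∧ y * x = b := by
  have := hR.1
  obtain ⟨e, he, hke⟩ := hR.exists_infinite hk hk0
  obtain ⟨y, x, hy, hx, rfl⟩ := he.factor b
  have hkx : k * x = x := by rw [← hx, ← mul_assoc, hke]
  exact ⟨y * k, x, by rw [mul_assoc, hk.eq], hkx, by rw [mul_assoc, hkx]⟩

/-- Any idempotent is equivalent to a subidempotent of any nonzero idempotent. -/
theorem IsPurelyInfiniteSimple.exists_sub (hR : IsPurelyInfiniteSimple R) {p q : R}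
    (hp : IsIdempotentElem p) (hq : IsIdempotentElem q) (hq0 : q ≠ 0) :
    ∃ x y : R, y * x = p ∧ q * x = x ∧ y * q = y ∧ x * p = x ∧ p * y = y := by
  obtain ⟨y, x, hy, hx, hyx⟩ := hR.factor hq hq0 p
  refine ⟨x * p, p * y, ?_, ?_, ?_, ?_, ?_⟩
  · calc p * y * (x * p) = p * (y * x) * p := by simp only [mul_assoc]
      _ = p := by rw [hyx, hp.eq, hp.eq]
  · rw [← mul_assoc, hx]
  · rw [mul_assoc, hy]
  · rw [mul_assoc, hp.eq]
  · rw [← mul_assoc, hp.eq]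

/-- One round of the back and forth: `p` is matched with `r + d - r'`, where `r'` is a
subidempotent of `d`. -/
theorem IsPurelyInfiniteSimple.exchange_step (hR : IsPurelyInfiniteSimple R) {r d p : R}
    (hr : IsIdempotentElem r) (hd : IsIdempotentElem d) (hd0 : d ≠ 0)
    (hrd : r * d = 0) (hdr : d * r = 0) (hp : IsIdempotentElem p) (hp0 : p ≠ 0) :
    ∃ r' X Y : R, IsIdempotentElem r' ∧ d * r' = r' ∧ r' * d = r' ∧
      X * Y = p ∧ Y * X = r + d - r' ∧ p * X = X ∧ Y * p = Y := by
  obtain ⟨x, y, hyx, hpx, hyp, hxr, hry⟩ := hR.exists_sub hr hp hp0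
  -- `x * y` is the copy of `r` under `p`; its complement `s` is then copied under `d` as `z * t`,
  -- and `r'` is what is left of `d`.
  set s := p - x * y with hs
  have hps : p * s = s := by rw [hs, mul_sub, hp.eq, ← mul_assoc, hpx]
  have hsp : s * p = s := by rw [hs, sub_mul, hp.eq, mul_assoc, hyp]
  have hsx : s * x = 0 := by rw [hs, sub_mul, hpx, mul_assoc, hyx, hxr, sub_self]
  have hys : y * s = 0 := by rw [hs, mul_sub, hyp, ← mul_assoc, hyx, hry, sub_self]
  have hss : IsIdempotentElem s := by
    change s * s = s
    nth_rewrite 2 [hs]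
    rw [mul_sub, hsp, ← mul_assoc, hsx, zero_mul, sub_zero]
  obtain ⟨z, t, htz, hdz, htd, hzs, hst⟩ := hR.exists_sub hss hd hd0
  have hzt : z * t * (z * t) = z * t := by
    rw [mul_assoc, ← mul_assoc t, htz, hst]
  refine ⟨d - z * t, x + t, y + z, ?_, ?_, ?_, ?_, ?_, ?_, ?_⟩
  · change (d - z * t) * (d - z * t) = d - z * t
    rw [mul_sub, sub_mul, sub_mul, hd.eq, hzt, mul_assoc z, htd, ← mul_assoc d, hdz]
    abel
  · rw [mul_sub, hd.eq, ← mul_assoc, hdz]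
  · rw [sub_mul, hd.eq, mul_assoc, htd]
  · have h1 : x * z = 0 := by
      rw [← hxr, ← hdz, mul_assoc, ← mul_assoc r, hrd, zero_mul, mul_zero]
    have h2 : t * y = 0 := by
      rw [← htd, ← hry, mul_assoc, ← mul_assoc d, hdr, zero_mul, mul_zero]
    rw [mul_add, add_mul, add_mul, h1, h2, htz, hs]
    abel
  · have h1 : y * t = 0 := by rw [← hst, ← mul_assoc, hys, zero_mul]
    have h2 : z * x = 0 := by rw [← hzs, mul_assoc, hsx, mul_zero]
    rw [mul_add, add_mul, add_mul, h1, h2, hyx]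
    abel
  · rw [mul_add, hpx, ← hst, ← mul_assoc, hps]
  · rw [add_mul, hyp, ← hzs, mul_assoc, hsp]

end Comparison

/-! ### Idempotent local units and a decomposition of the unit -/

section LocalUnits

variable {R : Type u} [NonUnitalRing R]

theorem IsSigmaUnital.exists_units (hσ : IsSigmaUnital R) :
    ∃ w : ℕ → R, ∀ a, ∃ N, ∀ n ≥ N, w n * a = a ∧ a * w n = a := by
  obtain ⟨w, hw⟩ := hσ
  exact ⟨w, strictTendsto_iff.1 hw⟩

theorem IsSigmaUnital.exists_local_unit (hσ : IsSigmaUnital R) (a b c : R) :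
    ∃ w, (w * a = a ∧ a * w = a) ∧ (w * b = b ∧ b * w = b) ∧ (w * c = c ∧ c * w = c) := by
  obtain ⟨w, hw⟩ := hσ.exists_units
  obtain ⟨N₁, h₁⟩ := hw a
  obtain ⟨N₂, h₂⟩ := hw b
  obtain ⟨N₃, h₃⟩ := hw c
  exact ⟨w (max N₁ (max N₂ N₃)), h₁ _ (le_max_left _ _),
    h₂ _ ((le_max_left _ _).trans (le_max_right _ _)),
    h₃ _ ((le_max_right _ _).trans (le_max_right _ _))⟩

/-- A left unit `w` would be two-sided: a local unit `v` for `a` and `w` satisfies `w = w * v = v`.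
-/
theorem exists_mul_ne_of_not_isUnital (hσ : IsSigmaUnital R) (hu : ¬ IsUnital R) (w : R) :
    ∃ a, a - w * a ≠ 0 := by
  by_contra! h
  replace h : ∀ a, w * a = a := fun a => (sub_eq_zero.1 (h a)).symm
  refine hu ⟨w, fun a => ⟨h a, ?_⟩⟩
  obtain ⟨v, ⟨-, hav⟩, ⟨-, hwv⟩, -⟩ := hσ.exists_local_unit a w a
  rw [← hwv, h v, hav]

/-- Every element is annihilated on both sides by a nonzero idempotent. -/
theorem exists_orthogonal_idempotent (hR : IsPurelyInfiniteSimple R) (hσ : IsSigmaUnital R)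
    (hu : ¬ IsUnital R) (a : R) : ∃ k, IsIdempotentElem k ∧ k ≠ 0 ∧ a * k = 0 ∧ k * a = 0 := by
  obtain ⟨w, ⟨hwa, haw⟩, -, -⟩ := hσ.exists_local_unit a a a
  obtain ⟨v, ⟨-, hwv⟩, -, -⟩ := hσ.exists_local_unit w w w
  -- An infinite idempotent in the right ideal `(1 - v) R` is killed by `w` from the left;
  -- multiplying it by `1 - w` on the right then gives both annihilations.
  obtain ⟨g, ⟨x, hx⟩, hg⟩ :=
    hR.2 (AddMonoidHom.id R - AddMonoidHom.mulLeft v).range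
      (by
        rintro _ ⟨x, rfl⟩ r
        refine ⟨x * r, ?_⟩
        change x * r - v * (x * r) = (x - v * x) * r
        rw [sub_mul, mul_assoc])
      (by
        intro h
        obtain ⟨x, hx⟩ := exists_mul_ne_of_not_isUnital hσ hu v
        have : x - v * x ∈ (AddMonoidHom.id R - AddMonoidHom.mulLeft v).range := ⟨x, rfl⟩
        rw [h] at this
        exact hx this)
  change x - v * x = g at hx
  have hwg : w * g = 0 := by rw [← hx, mul_sub, ← mul_assoc, hwv, sub_self]
  have hgg := hg.1.eq
  have hag : a * g = 0 := by rw [← haw, mul_assoc, hwg, mul_zero]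
  refine ⟨g - g * w, ?_, ?_, ?_, ?_⟩
  · change (g - g * w) * (g - g * w) = g - g * w
    rw [sub_mul, mul_assoc g w, mul_sub w, ← mul_assoc w g, hwg, mul_sub, ← mul_assoc g g, hgg]
    simp
  · intro h
    apply hg.ne_zero
    calc g = (g - g * w) * g := by rw [sub_mul, mul_assoc, hwg, hgg, mul_zero, sub_zero]
      _ = 0 := by rw [h, zero_mul]
  · rw [mul_sub, ← mul_assoc, hag]; simp
  · rw [sub_mul, mul_assoc, hwa, sub_self]

/-- Every element has a two-sided idempotent unit. -/
theorem exists_idempotent_unit (hR : IsPurelyInfiniteSimple R) (hσ : IsSigmaUnital R)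
    (hu : ¬ IsUnital R) (a : R) : ∃ e, IsIdempotentElem e ∧ e * a = a ∧ a * e = a := by
  obtain ⟨w, ⟨hwa, haw⟩, -, -⟩ := hσ.exists_local_unit a a a
  obtain ⟨k, hk, hk0, hwk, hkw⟩ := exists_orthogonal_idempotent hR hσ hu w
  -- The element is chosen so that `(1 - d) * (1 - c) = 1` in the unitization. Then `(1 - c) * (1 -
  -- d)` is idempotent, and so is its complement `c + d - c * d`.
  obtain ⟨y, x, hy, hx, hyx⟩ := hR.factor hk hk0 (w + w - w * w + k)
  have hak : a * k = 0 := by rw [← haw, mul_assoc, hwk, mul_zero]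
  have hka : k * a = 0 := by rw [← hwa, ← mul_assoc, hkw, zero_mul]
  have hax : a * x = 0 := by rw [← hx, ← mul_assoc, hak, zero_mul]
  have hya : y * a = 0 := by rw [← hy, mul_assoc, hka, mul_zero]
  have hwx : w * x = 0 := by rw [← hx, ← mul_assoc, hwk, zero_mul]
  have hyw : y * w = 0 := by rw [← hy, mul_assoc, hkw, mul_zero]
  obtain ⟨c, hc⟩ : ∃ c, c = w + k - x := ⟨_, rfl⟩
  obtain ⟨d, hd⟩ : ∃ d, d = w + k - y := ⟨_, rfl⟩
  have hdc : d * c = c + d := by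
    have : d * c = w * w + w * k - w * x + (k * w + k * k - k * x)
        - (y * w + y * k - y * x) := by rw [hc, hd]; noncomm_ring
    rw [this, hwk, hwx, hkw, hk.eq, hx, hyw, hy, hyx, hc, hd]
    abel
  have hac : a * c = a := by rw [hc, mul_sub, mul_add, haw, hak, hax]; simp
  have hda : d * a = a := by rw [hd, sub_mul, add_mul, hwa, hka, hya]; simp
  have hde : d * (c + d - c * d) = c + d - c * d := by
    rw [mul_sub, mul_add, ← mul_assoc, hdc, add_mul]
    abel
  refine ⟨c + d - c * d, ?_, ?_, ?_⟩
  · change (c + d - c * d) * (c + d - c * d) = c + d - c * d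
    rw [sub_mul, add_mul, mul_assoc c d, hde]
    abel
  · rw [sub_mul, add_mul, mul_assoc, hda]
    abel
  · rw [mul_sub, mul_add, ← mul_assoc, hac]
    abel

theorem exists_larger_idempotent (hR : IsPurelyInfiniteSimple R) (hσ : IsSigmaUnital R)
    (hu : ¬ IsUnital R) (E c : R) : ∃ E', IsIdempotentElem E' ∧ (E' * E = E ∧ E * E' = E) ∧
      (E' * c = c ∧ c * E' = c) ∧ E' - E ≠ 0 := by
  obtain ⟨k, hk, hk0, hEk, -⟩ := exists_orthogonal_idempotent hR hσ hu E
  -- Covering `k`, which `E` kills, forces the new idempotent to differ from `E`.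
  obtain ⟨w, ⟨hwE, hEw⟩, ⟨hwc, hcw⟩, ⟨hwk, -⟩⟩ := hσ.exists_local_unit E c k
  obtain ⟨e, he, hew, hwe⟩ := exists_idempotent_unit hR hσ hu w
  refine ⟨e, he, ⟨?_, ?_⟩, ⟨?_, ?_⟩, ?_⟩
  · rw [← hwE, ← mul_assoc, hew]
  · rw [← hEw, mul_assoc, hwe]
  · rw [← hwc, ← mul_assoc, hew]
  · rw [← hcw, mul_assoc, hwe]
  · intro h
    apply hk0
    rw [← hwk, ← hew, mul_assoc, hwk, sub_eq_zero.1 h, hEk]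

/-- The unit of the multiplier ring is a strict sum of nonzero orthogonal idempotents. -/
theorem exists_idempotent_series (hR : IsPurelyInfiniteSimple R) (hσ : IsSigmaUnital R)
    (hu : ¬ IsUnital R) : ∃ e : ℕ → R, (∀ n, IsIdempotentElem (e n)) ∧ (∀ n, e n ≠ 0) ∧
      (∀ i j, i ≠ j → e i * e j = 0) ∧
      StrictTendsto (fun n => toMultiplier (∑ i ∈ Finset.range n, e i)) 1 := by
  obtain ⟨w, hw⟩ := hσ.exists_units
  choose next h1 h2 h3 h4 using exists_larger_idempotent hR hσ hu
  -- `E (n + 1)` is a unit for both `E n` and `w n`; the series consists of the increments.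
  let E : ℕ → R := fun n => Nat.rec 0 (fun n r => next r (w n)) n
  have hE : ∀ n, E (n + 1) = next (E n) (w n) := fun n => rfl
  have hid : ∀ n, IsIdempotentElem (E n) := by
    rintro (_ | n)
    · exact IsIdempotentElem.zero
    · exact h1 _ _
  have hmono : ∀ m n, m ≤ n → E n * E m = E m ∧ E m * E n = E m := by
    intro m n hmn
    induction n, hmn using Nat.le_induction with
    | base => exact ⟨(hid m).eq, (hid m).eq⟩
    | succ n _ ih =>
      have h := h2 (E n) (w n)
      rw [← hE] at h
      constructor
      · rw [← ih.1, ← mul_assoc, h.1]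
      · rw [← ih.2, mul_assoc, h.2]
  have horth : ∀ i j, i < j → (E (i + 1) - E i) * (E (j + 1) - E j) = 0 ∧
      (E (j + 1) - E j) * (E (i + 1) - E i) = 0 := by
    intro i j hij
    have a1 := hmono (i + 1) (j + 1) (by omega)
    have a2 := hmono (i + 1) j hij
    have a3 := hmono i (j + 1) (by omega)
    have a4 := hmono i j hij.le
    constructor
    · rw [sub_mul, mul_sub, mul_sub, a1.2, a2.2, a3.2, a4.2]; simp
    · rw [sub_mul, mul_sub, mul_sub, a1.1, a2.1, a3.1, a4.1]; simp
  refine ⟨fun n => E (n + 1) - E n, ?_, fun n => h4 _ _, ?_, ?_⟩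
  · intro n
    have h := hmono n (n + 1) (by omega)
    change (E (n + 1) - E n) * (E (n + 1) - E n) = E (n + 1) - E n
    rw [sub_mul, mul_sub, mul_sub, (hid (n + 1)).eq, (hid n).eq, h.1, h.2]; simp
  · intro i j hij
    rcases lt_or_gt_of_ne hij with h | h
    · exact (horth i j h).1
    · exact (horth j i h).2
  · rw [strictTendsto_iff]
    intro a
    obtain ⟨N, hN⟩ := hw a
    refine ⟨N + 1, fun n hn => ?_⟩
    obtain ⟨m, rfl⟩ : ∃ m, n = m + 1 := ⟨n - 1, by omega⟩
    have h := h3 (E m) (w m)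
    rw [← hE] at h
    have ha := hN m (by omega)
    have hE0 : E 0 = 0 := rfl
    rw [Finset.sum_range_sub, hE0, sub_zero, leftAct_toMultiplier, rightAct_toMultiplier,
      leftAct_one, rightAct_one]
    constructor
    · rw [← ha.1, ← mul_assoc, h.1]
    · rw [← ha.2, mul_assoc, h.2]

end LocalUnits

/-! ### Back and forth between the two series -/

section BackAndForth

variable {R : Type u} [NonUnitalRing R]

/-- The idempotents `p n` are equivalent to `r n + e (n + 1) - r (n + 1)`, for suitable
subidempotents `r n` of `e n`. -/
theorem IsPurelyInfiniteSimple.exists_matching (hR : IsPurelyInfiniteSimple R) {p e : ℕ → R}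
    (hp : ∀ n, IsIdempotentElem (p n)) (hp0 : ∀ n, p n ≠ 0)
    (he : ∀ n, IsIdempotentElem (e n)) (he0 : ∀ n, e n ≠ 0)
    (heo : ∀ i j, i ≠ j → e i * e j = 0) :
    ∃ r x y : ℕ → R, r 0 = e 0 ∧ (∀ n, e n * r n = r n) ∧ (∀ n, r n * e n = r n) ∧
      (∀ n, IsIdempotentElem (r n)) ∧
      (∀ n, x n * y n = p n) ∧ (∀ n, y n * x n = r n + e (n + 1) - r (n + 1)) ∧
      (∀ n, p n * x n = x n) ∧ (∀ n, y n * p n = y n) := by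
  have step : ∀ n r, IsIdempotentElem r ∧ e n * r = r ∧ r * e n = r → ∃ r' X Y : R,
      (IsIdempotentElem r' ∧ e (n + 1) * r' = r' ∧ r' * e (n + 1) = r') ∧
      X * Y = p n ∧ Y * X = r + e (n + 1) - r' ∧ p n * X = X ∧ Y * p n = Y := by
    rintro n r ⟨hr, her, hre⟩
    obtain ⟨r', X, Y, h1, h2, h3, h⟩ := hR.exchange_step (r := r) hr (he (n + 1)) (he0 _)
      (by rw [← hre, mul_assoc, heo _ _ (by omega), mul_zero])
      (by rw [← her, ← mul_assoc, heo _ _ (by omega), zero_mul]) (hp n) (hp0 n)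
    exact ⟨r', X, Y, ⟨h1, h2, h3⟩, h⟩
  choose next X Y hnext hXY hYX hpX hYp using step
  let r : (n : ℕ) → {r : R // IsIdempotentElem r ∧ e n * r = r ∧ r * e n = r} := fun n =>
    Nat.rec ⟨e 0, he 0, he 0, he 0⟩ (fun n r => ⟨next n r.1 r.2, hnext n r.1 r.2⟩) n
  exact ⟨fun n => (r n).1, fun n => X n (r n).1 (r n).2, fun n => Y n (r n).1 (r n).2, rfl,
    fun n => (r n).2.2.1, fun n => (r n).2.2.2, fun n => (r n).2.1,
    fun n => hXY _ _ _, fun n => hYX _ _ _, fun n => hpX _ _ _, fun n => hYp _ _ _⟩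

/-- Neighbouring terms share only `e (i + 1)`, of which one uses `r (i + 1)` and the other its
complement. -/
theorem shifted_orthogonal {e r : ℕ → R} (heo : ∀ i j, i ≠ j → e i * e j = 0) (her : ∀ n, e n * r n = r n)
    (hre : ∀ n, r n * e n = r n) (hr : ∀ n, IsIdempotentElem (r n)) (i j : ℕ) (hij : i ≠ j) :
    (r i + e (i + 1) - r (i + 1)) * (r j + e (j + 1) - r (j + 1)) = 0 := by
  have h1 : ∀ i j, i ≠ j → r i * r j = 0 := fun i j h => by
    rw [← hre i, ← her j, mul_assoc, ← mul_assoc (e i), heo i j h, zero_mul, mul_zero]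
  have h2 : ∀ i j, i ≠ j → (e i - r i) * (e j - r j) = 0 := fun i j h => by
    rw [sub_mul, mul_sub, mul_sub, heo i j h, h1 i j h, ← her j, ← mul_assoc, heo i j h,
      ← hre i, mul_assoc, heo i j h]
    simp
  have h3 : ∀ i j, r i * (e j - r j) = 0 := fun i j => by
    rcases eq_or_ne i j with rfl | h
    · rw [mul_sub, hre, (hr i).eq, sub_self]
    · rw [mul_sub, h1 i j h, ← hre i, mul_assoc, heo i j h]; simp
  have h4 : ∀ i j, (e i - r i) * r j = 0 := fun i j => by
    rcases eq_or_ne i j with rfl | h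
    · rw [sub_mul, her, (hr i).eq, sub_self]
    · rw [sub_mul, h1 i j h, ← her j, ← mul_assoc, heo i j h]; simp
  rw [add_sub_assoc, add_sub_assoc, add_mul, mul_add, mul_add, h1 i j hij, h3, h4,
    h2 _ _ (by omega)]
  simp

theorem shifted_tendsto {e r : ℕ → R} {Q : multiplierRing R} (hr0 : r 0 = e 0)
    (her : ∀ n, e n * r n = r n) (hre : ∀ n, r n * e n = r n)
    (hQ : StrictTendsto (fun n => toMultiplier (∑ i ∈ Finset.range n, e i)) Q) :
    StrictTendsto (fun n => toMultiplier
      (∑ i ∈ Finset.range n, (r i + e (i + 1) - r (i + 1)))) Q := by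
  have hsum : ∀ n, ∑ i ∈ Finset.range n, (r i + e (i + 1) - r (i + 1)) =
      ∑ i ∈ Finset.range (n + 1), e i - r n := by
    intro n
    induction n with
    | zero => simp [hr0]
    | succ n ih => rw [Finset.sum_range_succ, ih, Finset.sum_range_succ _ (n + 1)]; abel
  have hterms := hQ.terms
  rw [strictTendsto_iff] at hQ ⊢
  intro a
  obtain ⟨N, hN⟩ := hQ a
  obtain ⟨M, hM⟩ := hterms a
  refine ⟨max N M, fun n hn => ?_⟩
  have h1 := hN (n + 1) ((le_of_max_le_left hn).trans n.le_succ)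
  have h2 := hM n (le_of_max_le_right hn)
  have h3 : r n * a = 0 := by rw [← hre, mul_assoc, h2.1, mul_zero]
  have h4 : a * r n = 0 := by rw [← her, ← mul_assoc, h2.2, zero_mul]
  rw [leftAct_toMultiplier, rightAct_toMultiplier] at h1 ⊢
  rw [hsum, sub_mul, mul_sub, h3, h4, sub_zero, sub_zero]
  exact h1

end BackAndForth

end PurelyInfinite

theorem lemma2p4 {R : Type*} [NonUnitalRing R]
    (hR : PurelyInfinite.IsPurelyInfiniteSimple R)
    (hσ : PurelyInfinite.IsSigmaUnital R)
    (hu : ¬ PurelyInfinite.IsUnital R)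
    (p : ℕ → R)
    (hp : ∀ n, IsIdempotentElem (p n))
    (hp0 : ∀ n, p n ≠ 0)
    (hpo : ∀ i j, i ≠ j → p i * p j = 0)
    (P : PurelyInfinite.multiplierRing R)
    (hP : PurelyInfinite.StrictTendsto
      (fun n : ℕ => PurelyInfinite.toMultiplier (∑ i ∈ Finset.range n, p i)) P) :
    PurelyInfinite.IdemEquiv P 1 := by
  obtain ⟨e, he, he0, heo, heQ⟩ := PurelyInfinite.exists_idempotent_series hR hσ hu
  obtain ⟨r, x, y, hr0, her, hre, hr, hxy, hyx, hpx, hyp⟩ := hR.exists_matching hp hp0 he he0 heo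
  obtain ⟨X, Y, hXY, hYX⟩ := PurelyInfinite.exists_mul_eq_of_series hP
    (PurelyInfinite.shifted_tendsto hr0 her hre heQ) hpo
    (PurelyInfinite.shifted_orthogonal heo her hre hr) hxy hyx hpx hyp
  refine ⟨?_, IsIdempotentElem.one, X, Y, hXY, hYX⟩
  change P * P = P
  rw [← hXY, mul_assoc, ← mul_assoc Y, hYX, one_mul]
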